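/- Let $G$ be a group and $N$ a normal subgroup. A mixed commutator is an element $[g,w]=gwg^{-1}w^{-1}$ with $g\in G$, $w\in N$, and $[G,N]$ is the subgroup generated by the mixed commutators. For $x\in[G,N]$ let $\mathrm{cl}_{G,N}(x)$ be the least number of mixed commutators whose product is $x$, and let $\mathrm{scl}_{G,N}(x)=\lim_{m\to\infty}\mathrm{cl}_{G,N}(x^m)/m$ (this limit exists); put $\mathrm{scl}_G=\mathrm{scl}_{G,G}$. One says that $\mathrm{scl}_G$ and $\mathrm{scl}_{G,N}$ are equivalent if there is a real constant $C>0$ such that $\mathrm{scl}_{G,N}(x)\le C\cdot\mathrm{scl}_G(x)$ for every $x\in[G,N]$. Theorem. Let $\ell\ge 2$ be an integer, let $R_\ell=\langle a,b\mid [a,b]^\ell\rangle$, and let $R_\ell'=[R_\ell,R_\ell]$ be its commutator subgroup. Then $\mathrm{scl}_{R_\ell}$ and $\mathrm{scl}_{R_\ell,R_\ell'}$ are not equivalent. -/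

import Mathlib

open Filter Topology
open scoped commutatorElement

/-- `IsMixedCommutatorProduct N k x`: `x` is a product of exactly `k` mixed commutators
`⁅g, w⁆ = g * w * g⁻¹ * w⁻¹` with `g : G` and `w ∈ N`. -/
def IsMixedCommutatorProduct {G : Type*} [Group G] (N : Subgroup G) (k : ℕ) (x : G) : Prop :=
  ∃ L : List (G × N), L.length = k ∧ (L.map fun p => ⁅p.1, (p.2 : G)⁆).prod = x

/-- The mixed commutator length `cl_{G,N}(x)`, the least number of mixed commutators whose
product is `x`; meaningful for `x ∈ ⁅⊤, N⁆`, the mixed commutator subgroup `[G,N]`. -/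
noncomputable def mixedCommutatorLength {G : Type*} [Group G] (N : Subgroup G) (x : G) : ℕ :=
  sInf {k | IsMixedCommutatorProduct N k x}

/-- The stable mixed commutator length `scl_{G,N}(x) = lim_{m → ∞} cl_{G,N}(x ^ m) / m`;
meaningful for `x ∈ ⁅⊤, N⁆`, where the limit exists
(see `tendsto_stableMixedCommutatorLength`). -/
noncomputable def stableMixedCommutatorLength {G : Type*} [Group G] (N : Subgroup G) (x : G) : ℝ :=
  limUnder atTop fun m : ℕ => (mixedCommutatorLength N (x ^ m) : ℝ) / m

/-- The stable commutator length `scl_G`, i.e. the case `N = G`. -/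
noncomputable def stableCommutatorLength {G : Type*} [Group G] (x : G) : ℝ :=
  stableMixedCommutatorLength (⊤ : Subgroup G) x

/-- `scl_G` and `scl_{G,N}` are equivalent (on `[G,N]`): there is `C > 0` with
`scl_{G,N} ≤ C * scl_G` on `[G,N]`. -/
def SclEquivalent {G : Type*} [Group G] (N : Subgroup G) [N.Normal] : Prop :=
  ∃ C : ℝ, 0 < C ∧ ∀ x ∈ ⁅(⊤ : Subgroup G), N⁆,
    stableMixedCommutatorLength N x ≤ C * stableCommutatorLength x

/-- The one-relator group `R_ℓ = ⟨a, b | [a, b] ^ ℓ⟩`, with `a` and `b` the generators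
indexed by `0` and `1`. -/
abbrev OneRelatorGroup (ℓ : ℕ) : Type :=
  PresentedGroup ({⁅FreeGroup.of (0 : Fin 2), FreeGroup.of (1 : Fin 2)⁆ ^ ℓ} : Set (FreeGroup (Fin 2)))

theorem IsMixedCommutatorProduct.mul {G : Type*} [Group G] {N : Subgroup G} {j k : ℕ} {x y : G}
    (hx : IsMixedCommutatorProduct N j x) (hy : IsMixedCommutatorProduct N k y) :
    IsMixedCommutatorProduct N (j + k) (x * y) := by
  obtain ⟨L, rfl, rfl⟩ := hx
  obtain ⟨M, rfl, rfl⟩ := hy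
  exact ⟨L ++ M, by simp, by simp⟩

theorem IsMixedCommutatorProduct.inv {G : Type*} [Group G] {N : Subgroup G} [hN : N.Normal]
    {k : ℕ} {x : G} (hx : IsMixedCommutatorProduct N k x) :
    IsMixedCommutatorProduct N k x⁻¹ := by
  obtain ⟨L, rfl, rfl⟩ := hx
  induction L with
  | nil => exact ⟨[], rfl, by simp⟩
  | cons p L ih =>
    have h1 : IsMixedCommutatorProduct N 1 ⁅p.1, (p.2 : G)⁆⁻¹ :=
      ⟨[(p.1⁻¹, ⟨p.1 * p.2 * p.1⁻¹, hN.conj_mem _ p.2.2 _⟩)], rfl, by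
        simp only [List.map_cons, List.map_nil, List.prod_singleton, commutatorElement_def]
        group⟩
    simpa using ih.mul h1

/-- On the mixed commutator subgroup the mixed commutator length is attained. -/
theorem isMixedCommutatorProduct_mixedCommutatorLength {G : Type*} [Group G] (N : Subgroup G)
    [N.Normal] {x : G} (hx : x ∈ ⁅(⊤ : Subgroup G), N⁆) :
    IsMixedCommutatorProduct N (mixedCommutatorLength N x) x := by
  refine Nat.sInf_mem (s := {k | IsMixedCommutatorProduct N k x}) ?_
  change ∃ k, IsMixedCommutatorProduct N k x
  rw [Subgroup.commutator_def] at hx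
  induction hx using Subgroup.closure_induction with
  | mem x h =>
    obtain ⟨g, -, w, hw, rfl⟩ := h
    exact ⟨1, [(g, ⟨w, hw⟩)], rfl, by simp⟩
  | one => exact ⟨0, [], rfl, rfl⟩
  | mul x y _ _ hx hy =>
    obtain ⟨j, hj⟩ := hx
    obtain ⟨k, hk⟩ := hy
    exact ⟨_, hj.mul hk⟩
  | inv x _ hx =>
    obtain ⟨j, hj⟩ := hx
    exact ⟨_, hj.inv⟩

/-- The limit that defines the stable mixed commutator length exists on `[G,N]`. -/
theorem tendsto_stableMixedCommutatorLength {G : Type*} [Group G] (N : Subgroup G)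
    [N.Normal] {x : G} (hx : x ∈ ⁅(⊤ : Subgroup G), N⁆) :
    Tendsto (fun m : ℕ => (mixedCommutatorLength N (x ^ m) : ℝ) / m) atTop
      (𝓝 (stableMixedCommutatorLength N x)) := by
  have hsub : Subadditive fun m : ℕ => (mixedCommutatorLength N (x ^ m) : ℝ) := by
    intro m n
    simp only [pow_add]
    exact_mod_cast Nat.sInf_le
      ((isMixedCommutatorProduct_mixedCommutatorLength N (pow_mem hx m)).mul
        (isMixedCommutatorProduct_mixedCommutatorLength N (pow_mem hx n)))
  have hbdd : BddBelow (Set.range fun m : ℕ => (mixedCommutatorLength N (x ^ m) : ℝ) / m) :=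
    ⟨0, by rintro _ ⟨m, rfl⟩; positivity⟩
  exact tendsto_nhds_limUnder ⟨_, hsub.tendsto_lim hbdd⟩

/-!
The commutators `⁅a ^ n, b ^ ℓ⁆` satisfy `scl_G ≤ 1`, and they lie in `[R_ℓ, R_ℓ']` because
`⁅a, b⁆ ^ ℓ = 1`. Their areas `n * ℓ`, read off as the central coordinate in the Heisenberg group,
are unbounded. Area is additive on commutator subgroups and vanishes on mixed commutators, but on
`R_ℓ` it is only defined modulo `ℓ`. To remove the ambiguity, choose lifts `A`, `B` of circle
homeomorphisms such that `⁅A, B⁆ ^ ℓ` is the unit translation: then the area minus `ℓ` times the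
displacement of `0` is well defined on `R_ℓ`. The displacement is a quasimorphism, so the corrected
area is still almost additive on `R_ℓ'`, bounded on mixed commutators, and unbounded on the
`⁅a ^ n, b ^ ℓ⁆`, whence `scl_{R_ℓ, R_ℓ'}` is unbounded there.
-/

/-- `f` is a quasimorphism of defect `D` on the subgroup `N`, and is bounded by `K` on the mixed
commutators `⁅g, w⁆` with `w ∈ N`. Such functions bound `scl_{G,N}` from below; the values of `f`
outside `N` are irrelevant. -/
structure IsMixedQuasimorphism {G : Type*} [Group G] (N : Subgroup G) (f : G → ℝ) (D K : ℝ) :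
    Prop where
  abs_map_mul_sub_le : ∀ v ∈ N, ∀ w ∈ N, |f (v * w) - f v - f w| ≤ D
  abs_map_commutator_le : ∀ g : G, ∀ w ∈ N, |f ⁅g, w⁆| ≤ K

theorem stableCommutatorLength_commutatorElement_le_one {G : Type*} [Group G] (g h : G) :
    stableCommutatorLength ⁅g, h⁆ ≤ 1 := by
  have hmem : ⁅g, h⁆ ∈ ⁅(⊤ : Subgroup G), (⊤ : Subgroup G)⁆ :=
    Subgroup.commutator_mem_commutator trivial trivial
  refine le_of_tendsto (tendsto_stableMixedCommutatorLength ⊤ hmem) (.of_forall fun m => ?_)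
  have hprod : IsMixedCommutatorProduct ⊤ m (⁅g, h⁆ ^ m) :=
    ⟨List.replicate m (g, ⟨h, trivial⟩), by simp, by simp⟩
  exact div_le_one_of_le₀ (by exact_mod_cast Nat.sInf_le hprod) (Nat.cast_nonneg m)

namespace IsMixedQuasimorphism

variable {G H : Type*} [Group G] [Group H] {N : Subgroup G} {f f' : G → ℝ} {D D' K K' : ℝ}

theorem of_abs_map_mul_sub_le (hf : ∀ v w, |f (v * w) - f v - f w| ≤ D) :
    IsMixedQuasimorphism ⊤ f D (3 * D) where
  abs_map_mul_sub_le v _ w _ := hf v w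
  abs_map_commutator_le v w _ := by
    have h₁ := hf ⁅v, w⁆ (w * v)
    have h₂ := hf v w
    have h₃ := hf w v
    rw [show ⁅v, w⁆ * (w * v) = v * w by rw [commutatorElement_def]; group] at h₁
    rw [abs_le] at *
    constructor <;> linarith

theorem const_mul (hf : IsMixedQuasimorphism N f D K) (c : ℝ) :
    IsMixedQuasimorphism N (fun g => c * f g) (|c| * D) (|c| * K) where
  abs_map_mul_sub_le v hv w hw := by
    rw [← mul_sub, ← mul_sub, abs_mul]
    exact mul_le_mul_of_nonneg_left (hf.abs_map_mul_sub_le v hv w hw) (abs_nonneg c)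
  abs_map_commutator_le g w hw := by
    rw [abs_mul]
    exact mul_le_mul_of_nonneg_left (hf.abs_map_commutator_le g w hw) (abs_nonneg c)

theorem sub (hf : IsMixedQuasimorphism N f D K) (hf' : IsMixedQuasimorphism N f' D' K') :
    IsMixedQuasimorphism N (fun g => f g - f' g) (D + D') (K + K') where
  abs_map_mul_sub_le v hv w hw := by
    rw [show f (v * w) - f' (v * w) - (f v - f' v) - (f w - f' w) =
      (f (v * w) - f v - f w) - (f' (v * w) - f' v - f' w) by ring]
    exact (abs_sub _ _).trans
      (add_le_add (hf.abs_map_mul_sub_le v hv w hw) (hf'.abs_map_mul_sub_le v hv w hw))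
  abs_map_commutator_le g w hw := (abs_sub _ _).trans
    (add_le_add (hf.abs_map_commutator_le g w hw) (hf'.abs_map_commutator_le g w hw))

theorem comp (hf : IsMixedQuasimorphism N f D K) (φ : H →* G) {M : Subgroup H}
    (hM : M ≤ N.comap φ) : IsMixedQuasimorphism M (f ∘ φ) D K where
  abs_map_mul_sub_le v hv w hw := by
    simpa only [Function.comp_apply, map_mul] using
      hf.abs_map_mul_sub_le _ (hM hv) _ (hM hw)
  abs_map_commutator_le g w hw := by
    simpa only [Function.comp_apply, map_commutatorElement] using
      hf.abs_map_commutator_le (φ g) _ (hM hw)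

theorem of_comp {φ : G →* H} (hφ : Function.Surjective φ) {f : H → ℝ}
    (hf : IsMixedQuasimorphism N (f ∘ φ) D K) : IsMixedQuasimorphism (N.map φ) f D K where
  abs_map_mul_sub_le := by
    rintro _ ⟨v, hv, rfl⟩ _ ⟨w, hw, rfl⟩
    simpa only [Function.comp_apply, map_mul] using hf.abs_map_mul_sub_le v hv w hw
  abs_map_commutator_le := by
    rintro g _ ⟨w, hw, rfl⟩
    obtain ⟨g, rfl⟩ := hφ g
    simpa only [Function.comp_apply, map_commutatorElement] using
      hf.abs_map_commutator_le g w hw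

theorem abs_le_of_isMixedCommutatorProduct [N.Normal] (hf : IsMixedQuasimorphism N f D K) {k : ℕ}
    {x : G} (hx : IsMixedCommutatorProduct N k x) : |f x| ≤ k * (K + D) + D := by
  obtain ⟨L, rfl, rfl⟩ := hx
  suffices h : (L.map fun p => ⁅p.1, (p.2 : G)⁆).prod ∈ N ∧
      |f (L.map fun p => ⁅p.1, (p.2 : G)⁆).prod| ≤ L.length * (K + D) + D from h.2
  induction L with
  | nil => simpa [one_mem] using hf.abs_map_mul_sub_le 1 (one_mem N) 1 (one_mem N)
  | cons p L ih =>
    obtain ⟨hmem, hle⟩ := ih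
    have hp : ⁅p.1, (p.2 : G)⁆ ∈ N :=
      Subgroup.commutator_le_right ⊤ N (Subgroup.commutator_mem_commutator trivial p.2.2)
    simp only [List.map_cons, List.prod_cons, List.length_cons, Nat.cast_add, Nat.cast_one]
    refine ⟨mul_mem hp hmem, ?_⟩
    have h₁ := hf.abs_map_mul_sub_le _ hp _ hmem
    have h₂ := hf.abs_map_commutator_le p.1 p.2 p.2.2
    rw [abs_le] at *
    constructor <;> linarith

theorem abs_map_pow_sub_le (hf : IsMixedQuasimorphism N f D K) {x : G} (hx : x ∈ N) (m : ℕ) :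
    |f (x ^ m) - m * f x| ≤ (m + 1) * D := by
  induction m with
  | zero => simpa using hf.abs_map_mul_sub_le 1 (one_mem N) 1 (one_mem N)
  | succ m ih =>
    have := hf.abs_map_mul_sub_le _ (pow_mem hx m) _ hx
    rw [pow_succ]
    push_cast
    rw [abs_le] at *
    constructor <;> linarith

theorem abs_sub_le_mul_stableMixedCommutatorLength [N.Normal] (hf : IsMixedQuasimorphism N f D K)
    {x : G} (hx : x ∈ ⁅(⊤ : Subgroup G), N⁆) :
    |f x| - D ≤ stableMixedCommutatorLength N x * (K + D) := by
  have hxN : x ∈ N := Subgroup.commutator_le_right _ _ hx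
  have hlim := ((tendsto_stableMixedCommutatorLength N hx).mul_const (K + D)).add
    (tendsto_const_div_atTop_nhds_zero_nat (2 * D))
  rw [add_zero] at hlim
  refine ge_of_tendsto hlim ?_
  filter_upwards [eventually_gt_atTop 0] with m hm
  have hm' : (0 : ℝ) < m := by exact_mod_cast hm
  have hprod := hf.abs_le_of_isMixedCommutatorProduct
    (isMixedCommutatorProduct_mixedCommutatorLength N (pow_mem hx m))
  have hpow := hf.abs_map_pow_sub_le hxN m
  have htri : m * |f x| ≤ |f (x ^ m)| + |f (x ^ m) - m * f x| := by
    rw [← Nat.abs_cast m, ← abs_mul, Nat.abs_cast, abs_sub_comm]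
    simpa using abs_add_le (f (x ^ m)) (m * f x - f (x ^ m))
  rw [div_mul_eq_mul_div, ← add_div, le_div_iff₀ hm']
  linarith

theorem not_sclEquivalent [N.Normal] (hf : IsMixedQuasimorphism N f D K)
    (hunbdd : ∀ M, ∃ g h : G, ⁅g, h⁆ ∈ ⁅(⊤ : Subgroup G), N⁆ ∧ M < |f ⁅g, h⁆|) :
    ¬ SclEquivalent N := by
  rintro ⟨C, hC, hle⟩
  have hD : 0 ≤ D := (abs_nonneg _).trans (hf.abs_map_mul_sub_le 1 (one_mem N) 1 (one_mem N))
  have hK : 0 ≤ K := (abs_nonneg _).trans (hf.abs_map_commutator_le 1 1 (one_mem N))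
  obtain ⟨g, h, hmem, hlt⟩ := hunbdd (C * (K + D) + D)
  have hscl : stableMixedCommutatorLength N ⁅g, h⁆ ≤ C :=
    (hle _ hmem).trans (mul_le_of_le_one_right hC.le
      (stableCommutatorLength_commutatorElement_le_one g h))
  have hlower := hf.abs_sub_le_mul_stableMixedCommutatorLength hmem
  have hupper := mul_le_mul_of_nonneg_right hscl (add_nonneg hK hD)
  linarith

end IsMixedQuasimorphism

theorem isMixedQuasimorphism_circleDeg1Lift_map_zero :
    IsMixedQuasimorphism (⊤ : Subgroup CircleDeg1Liftˣ) (fun u => u 0) 1 3 := by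
  have hdefect (u v : CircleDeg1Liftˣ) : |(u * v) 0 - u 0 - v 0| ≤ 1 := by
    simpa [Real.dist_eq, sub_sub, abs_sub_comm] using
      ((u : CircleDeg1Lift).dist_map_map_zero_lt v).le
  simpa using IsMixedQuasimorphism.of_abs_map_mul_sub_le (f := fun u : CircleDeg1Liftˣ => u 0)
    hdefect

theorem exists_circleDeg1Lift_eqOn {h : ℝ → ℝ} {c : ℝ}
    (hcont : ContinuousOn h (Set.Icc c (c + 1))) (hmono : StrictMonoOn h (Set.Icc c (c + 1)))
    (hper : h (c + 1) = h c + 1) :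
    ∃ u : CircleDeg1Liftˣ, Set.EqOn u h (Set.Icc c (c + 1)) := by
  let φ : ℝ → ℝ := fun s => h (c + s) - (c + s)
  let H : ℝ → ℝ := fun x => x + φ (Int.fract (x - c))
  have hφ : φ 0 = φ 1 := by simp only [φ, add_zero, hper]; ring
  have hφcont : ContinuousOn φ (Set.Icc 0 1) :=
    (hcont.comp (by fun_prop) fun s hs => ⟨by linarith [hs.1], by linarith [hs.2]⟩).sub
      (by fun_prop)
  have hHcont : Continuous H :=
    continuous_id.add ((hφcont.comp_fract'' hφ).comp (continuous_id.sub continuous_const))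
  have hHh : Set.EqOn H h (Set.Icc c (c + 1)) := by
    rintro x ⟨hcx, hx⟩
    obtain rfl | hlt := hx.eq_or_lt
    · simp only [H, φ, add_sub_cancel_left, Int.fract_one, add_zero, hper]
      ring
    · simp [H, φ, Int.fract_eq_self.2 ⟨sub_nonneg.2 hcx, sub_lt_iff_lt_add'.2 hlt⟩]
  let g : AddConstMap ℝ ℝ 1 1 := ⟨H, fun x => by
    simp only [H, add_sub_right_comm, Int.fract_add_one]
    ring⟩
  have hHmono : StrictMono H :=
    (AddConstMapClass.strictMono_iff_Icc (f := g) one_pos c).2 (hmono.congr hHh.symm)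
  let f : CircleDeg1Lift := ⟨⟨H, hHmono.monotone⟩, g.map_add_const'⟩
  obtain ⟨u, hu⟩ : IsUnit f := CircleDeg1Lift.isUnit_iff_bijective.2
    ⟨hHmono.injective, f.continuous_iff_surjective.1 hHcont⟩
  exact ⟨u, hu ▸ hHh⟩

theorem exists_circleDeg1Lift_two_affine_pieces {a b y z σ ρ : ℝ} (hab : a < b) (hba : b < a + 1)
    (hσ : 0 ≤ σ) (hρ : 0 ≤ ρ) (hρ' : ρ < 1) (ha : σ * (y - a) = ρ * (a + 1 - z))
    (hb : σ * (b - y) = ρ * (z - b)) :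
    ∃ A : CircleDeg1Liftˣ, (∀ t ∈ Set.Icc a b, A t = t + σ * (t - y)) ∧
      ∀ t ∈ Set.Icc b (a + 1), A t = t + ρ * (z - t) := by
  have hleft {t : ℝ} (ht : t ≤ b) : t + σ * (t - y) ≤ t + ρ * (z - t) := by nlinarith
  have hright {t : ℝ} (ht : b ≤ t) : t + ρ * (z - t) ≤ t + σ * (t - y) := by nlinarith
  have hmono : StrictMono fun t => min (t + σ * (t - y)) (t + ρ * (z - t)) :=
    fun s t hst => min_lt_min (by nlinarith) (by nlinarith)
  obtain ⟨A, hA⟩ := exists_circleDeg1Lift_eqOn (c := a) (by fun_prop) (hmono.strictMonoOn _) (by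
    rw [min_eq_right (hright hba.le), min_eq_left (hleft hab.le)]
    linear_combination ha)
  refine ⟨A, fun t ht => ?_, fun t ht => ?_⟩
  · exact (hA ⟨ht.1, ht.2.trans hba.le⟩).trans (min_eq_left (hleft ht.2))
  · exact (hA ⟨hab.le.trans ht.1, ht.2⟩).trans (min_eq_right (hright ht.1))

theorem commutatorElement_eq_translate {A B : CircleDeg1Liftˣ} {r c : ℝ}
    (h : ∀ t ∈ Set.Ico c (c + 1), A (B t) = r + B (A t)) :
    ⁅A, B⁆ = CircleDeg1Lift.translate (Multiplicative.ofAdd r) := by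
  rw [commutatorElement_def, mul_inv_eq_iff_eq_mul, mul_inv_eq_iff_eq_mul]
  ext t
  simp only [Units.val_mul, CircleDeg1Lift.mul_apply, CircleDeg1Lift.translate_apply]
  have := h (t - ⌊t - c⌋)
    ⟨by linarith [Int.floor_le (t - c)], by linarith [Int.lt_floor_add_one (t - c)]⟩
  simp only [CircleDeg1Lift.map_sub_int] at this
  linarith

theorem mapsTo_Icc_of_fixed {f : CircleDeg1Lift} {x y : ℝ} (hx : f x = x) (hy : f y = y) :
    Set.MapsTo f (Set.Icc x y) (Set.Icc x y) := by
  simpa only [hx, hy] using f.monotone.mapsTo_Icc (a := x) (b := y)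

/- `A` has breakpoints `0, u` and fixed points `v, v - u + 1`; `B` has breakpoints `v - u, v` and
fixed points `0, u`. As each map fixes the breakpoints of the other, both `t` and its image under
one map stay in a region where the other map is affine, and affine maps commute up to a constant. -/
theorem apply_apply_eq_add_of_affine_pieces {A B : CircleDeg1Liftˣ} {u v σ ρ : ℝ}
    (hv : 0 ≤ v) (hvu : v ≤ u) (huv : 2 * u ≤ v + 1)
    (h₁ : σ * v = ρ * (u - v)) (h₂ : σ * (u - v) = ρ * (v + 1 - 2 * u))
    (hA₁ : ∀ t ∈ Set.Icc 0 u, A t = t + σ * (t - v))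
    (hA₂ : ∀ t ∈ Set.Icc u 1, A t = t + ρ * (v - u + 1 - t))
    (hB₁ : ∀ t ∈ Set.Icc (v - u) v, B t = t + σ * t)
    (hB₂ : ∀ t ∈ Set.Icc v (v - u + 1), B t = t + ρ * (u - t))
    {t : ℝ} (ht : t ∈ Set.Icc (v - u) (v - u + 1)) : A (B t) = σ ^ 2 * v + B (A t) := by
  have hA₀ (s : ℝ) (hs : s ∈ Set.Icc (u - 1) 0) : A s = s + ρ * (v - u - s) := by
    have := hA₂ (s + 1) ⟨by linarith [hs.1], by linarith [hs.2]⟩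
    rw [CircleDeg1Lift.map_add_one] at this
    linarith
  have fixA₀ : A (v - u) = v - u := by simp [hA₀ (v - u) ⟨by linarith, by linarith⟩]
  have fixA₁ : A v = v := by simp [hA₁ v ⟨hv, hvu⟩]
  have fixA₂ : A (v - u + 1) = v - u + 1 := by rw [CircleDeg1Lift.map_add_one, fixA₀]
  have fixB₁ : B 0 = 0 := by simp [hB₁ 0 ⟨by linarith, hv⟩]
  have fixB₂ : B u = u := by simp [hB₂ u ⟨hvu, by linarith⟩]
  have fixB₀ : B (u - 1) = u - 1 := by simpa [fixB₂] using (B : CircleDeg1Lift).map_sub_nat u 1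
  have fixB₃ : B 1 = 1 := by simpa [fixB₁] using (B : CircleDeg1Lift).map_add_one 0
  obtain ⟨htl, htr⟩ := ht
  obtain htv | htv := le_total t v
  · rw [hB₁ (A t) (mapsTo_Icc_of_fixed fixA₀ fixA₁ ⟨htl, htv⟩)]
    obtain ht₀ | ht₀ := le_total t 0
    · rw [hA₀ (B t) (mapsTo_Icc_of_fixed fixB₀ fixB₁ ⟨by linarith, ht₀⟩), hA₀ t ⟨by linarith, ht₀⟩,
        hB₁ t ⟨htl, htv⟩]
      linear_combination -σ * h₁
    · rw [hA₁ (B t) (mapsTo_Icc_of_fixed fixB₁ fixB₂ ⟨ht₀, by linarith⟩), hA₁ t ⟨ht₀, by linarith⟩,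
        hB₁ t ⟨htl, htv⟩]
      ring
  · rw [hB₂ (A t) (mapsTo_Icc_of_fixed fixA₁ fixA₂ ⟨htv, htr⟩)]
    obtain htu | htu := le_total t u
    · rw [hA₁ (B t) (mapsTo_Icc_of_fixed fixB₁ fixB₂ ⟨by linarith, htu⟩), hA₁ t ⟨by linarith, htu⟩,
        hB₂ t ⟨htv, htr⟩]
      linear_combination -σ * h₁
    · rw [hA₂ (B t) (mapsTo_Icc_of_fixed fixB₂ fixB₃ ⟨htu, by linarith⟩), hA₂ t ⟨htu, by linarith⟩,
        hB₂ t ⟨htv, htr⟩]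
      linear_combination -σ * h₁ - ρ * h₂

theorem exists_commutatorElement_eq_translate {r : ℝ} (hr : 0 ≤ r) (hr' : r < 1) :
    ∃ A B : CircleDeg1Liftˣ,
      ⁅A, B⁆ = CircleDeg1Lift.translate (Multiplicative.ofAdd r) := by
  -- Closing up the two maps forces `ρ / σ = u / (1 - u)` and `v = u ^ 2`, so that `⁅A, B⁆`
  -- translates by `(σ * u) ^ 2`; any `u` with `√r < 1 - u` then makes `ρ < 1`.
  have hsqrt : √r < 1 := by simpa using Real.sqrt_lt_sqrt hr hr'
  have hsqrt₀ := Real.sqrt_nonneg r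
  obtain ⟨u, hu, hur⟩ : ∃ u, 0 < u ∧ u < 1 - √r := exists_between (sub_pos.2 hsqrt)
  have hu' : 0 < 1 - u := by linarith
  set σ := √r / u
  set ρ := √r / (1 - u)
  have hσ : 0 ≤ σ := by positivity
  have hρ : 0 ≤ ρ := by positivity
  have hρ' : ρ < 1 := (div_lt_one hu').2 (by linarith)
  have hσu : σ * u = √r := div_mul_cancel₀ _ hu.ne'
  have hρu : ρ * (1 - u) = √r := div_mul_cancel₀ _ hu'.ne'
  have h₁ : σ * u ^ 2 = ρ * (u - u ^ 2) := by linear_combination u * hσu - u * hρu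
  have h₂ : σ * (u - u ^ 2) = ρ * (u ^ 2 + 1 - 2 * u) := by
    linear_combination (1 - u) * hσu - (1 - u) * hρu
  obtain ⟨A, hA₁, hA₂⟩ := exists_circleDeg1Lift_two_affine_pieces (a := 0) (b := u) (y := u ^ 2)
    (z := u ^ 2 - u + 1) hu (by linarith) hσ hρ hρ' (by linarith) (by linarith)
  obtain ⟨B, hB₁, hB₂⟩ := exists_circleDeg1Lift_two_affine_pieces (a := u ^ 2 - u) (b := u ^ 2)
    (y := 0) (z := u) (by linarith) (by nlinarith) hσ hρ hρ' (by linarith) (by linarith)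
  simp only [zero_add, sub_zero] at hA₂ hB₁
  refine ⟨A, B, commutatorElement_eq_translate (c := u ^ 2 - u) fun t ht => ?_⟩
  rw [apply_apply_eq_add_of_affine_pieces (by positivity) (by nlinarith) (by nlinarith) h₁ h₂ hA₁
    hA₂ hB₁ hB₂ (Set.Ico_subset_Icc_self ht), ← mul_pow, hσu, Real.sq_sqrt hr]

theorem exists_commutatorElement_pow_eq_translate_one {ℓ : ℕ} (hℓ : 2 ≤ ℓ) :
    ∃ A B : CircleDeg1Liftˣ, ⁅A, B⁆ ^ ℓ = CircleDeg1Lift.translate (Multiplicative.ofAdd 1) := by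
  have hℓ' : (1 : ℝ) < ℓ := by exact_mod_cast hℓ
  obtain ⟨A, B, hAB⟩ := exists_commutatorElement_eq_translate (r := (ℓ : ℝ)⁻¹) (by positivity)
    (inv_lt_one_of_one_lt₀ hℓ')
  refine ⟨A, B, ?_⟩
  rw [hAB, CircleDeg1Lift.translate_pow, mul_inv_cancel₀ (by positivity)]

/-- The Heisenberg group over `R`; `⟨x, y, z⟩` stands for the upper unitriangular matrix
`[[1, x, z], [0, 1, y], [0, 0, 1]]`. -/
@[ext]
structure HeisenbergGroup (R : Type*) where
  x : R
  y : R
  z : R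

namespace HeisenbergGroup

variable {R : Type*} [CommRing R]

instance : Mul (HeisenbergGroup R) := ⟨fun u v => ⟨u.x + v.x, u.y + v.y, u.z + v.z + u.x * v.y⟩⟩

instance : One (HeisenbergGroup R) := ⟨⟨0, 0, 0⟩⟩

instance : Inv (HeisenbergGroup R) := ⟨fun u => ⟨-u.x, -u.y, -u.z + u.x * u.y⟩⟩

@[simp] theorem mul_x (u v : HeisenbergGroup R) : (u * v).x = u.x + v.x := rfl
@[simp] theorem mul_y (u v : HeisenbergGroup R) : (u * v).y = u.y + v.y := rfl
@[simp] theorem mul_z (u v : HeisenbergGroup R) : (u * v).z = u.z + v.z + u.x * v.y := rfl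
@[simp] theorem one_x : (1 : HeisenbergGroup R).x = 0 := rfl
@[simp] theorem one_y : (1 : HeisenbergGroup R).y = 0 := rfl
@[simp] theorem one_z : (1 : HeisenbergGroup R).z = 0 := rfl
@[simp] theorem inv_x (u : HeisenbergGroup R) : u⁻¹.x = -u.x := rfl
@[simp] theorem inv_y (u : HeisenbergGroup R) : u⁻¹.y = -u.y := rfl
@[simp] theorem inv_z (u : HeisenbergGroup R) : u⁻¹.z = -u.z + u.x * u.y := rfl

instance : Group (HeisenbergGroup R) :=
  Group.ofLeftAxioms (fun u v w => by ext <;> simp <;> ring) (fun u => by ext <;> simp)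
    (fun u => by ext <;> simp)

theorem commutatorElement_eq (u v : HeisenbergGroup R) :
    ⁅u, v⁆ = ⟨0, 0, u.x * v.y - v.x * u.y⟩ := by
  ext <;> simp [commutatorElement_def]; ring

theorem pow_x (u : HeisenbergGroup R) (n : ℕ) : (u ^ n).x = n * u.x := by
  induction n with
  | zero => simp
  | succ n ih => rw [pow_succ, mul_x, ih, Nat.cast_add_one, add_one_mul]

theorem pow_y (u : HeisenbergGroup R) (n : ℕ) : (u ^ n).y = n * u.y := by
  induction n with
  | zero => simp
  | succ n ih => rw [pow_succ, mul_y, ih, Nat.cast_add_one, add_one_mul]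

theorem central_pow (c : R) (n : ℕ) : (⟨0, 0, c⟩ : HeisenbergGroup R) ^ n = ⟨0, 0, n * c⟩ := by
  induction n with
  | zero => ext <;> simp
  | succ n ih => rw [pow_succ, ih]; ext <;> simp [add_one_mul]

theorem x_eq_zero_and_y_eq_zero_of_mem_commutator {u : HeisenbergGroup R}
    (hu : u ∈ commutator (HeisenbergGroup R)) : u.x = 0 ∧ u.y = 0 := by
  rw [commutator_eq_closure] at hu
  induction hu using Subgroup.closure_induction with
  | mem u h =>
    obtain ⟨v, w, rfl⟩ := h
    simp [commutatorElement_eq]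
  | one => simp
  | mul u v _ _ hu hv => simp [hu, hv]
  | inv u _ hu => simp [hu]

theorem isMixedQuasimorphism_z :
    IsMixedQuasimorphism (commutator (HeisenbergGroup ℝ)) HeisenbergGroup.z 0 0 where
  abs_map_mul_sub_le v hv w _ := by simp [(x_eq_zero_and_y_eq_zero_of_mem_commutator hv).1]
  abs_map_commutator_le g w hw := by
    simp [commutatorElement_eq, x_eq_zero_and_y_eq_zero_of_mem_commutator hw]

end HeisenbergGroup

theorem commutator_le_comap {G H : Type*} [Group G] [Group H] (φ : G →* H) :
    commutator G ≤ (commutator H).comap φ := by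
  rw [← Subgroup.map_le_iff_le_comap, commutator_def, commutator_def, Subgroup.map_commutator]
  exact Subgroup.commutator_mono le_top le_top

/-- The element of `HeisenbergGroup ℝ × CircleDeg1Liftˣ` combining the central element of area `c`
with the unit translation. -/
noncomputable def centralTranslation (c : ℝ) : HeisenbergGroup ℝ × CircleDeg1Liftˣ :=
  (⟨0, 0, c⟩, CircleDeg1Lift.translate (Multiplicative.ofAdd 1))

theorem centralTranslation_mem_center (c : ℝ) :
    centralTranslation c ∈ Subgroup.center (HeisenbergGroup ℝ × CircleDeg1Liftˣ) := by
  rw [Subgroup.mem_center_iff]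
  intro p
  refine Prod.ext ?_ ?_
  · ext <;> simp [centralTranslation, add_comm]
  · ext t
    simp [centralTranslation]

instance (c : ℝ) : (Subgroup.zpowers (centralTranslation c)).Normal where
  conj_mem q hq p := by
    have hcenter := Subgroup.zpowers_le.2 (centralTranslation_mem_center c) hq
    rwa [Subgroup.mem_center_iff.1 hcenter p, mul_inv_cancel_right]

/-- The central product of the Heisenberg group and the group of lifts of circle homeomorphisms
in which the unit translation is identified with the inverse of the central element of area `c`. -/
abbrev HeisenbergCircleGroup (c : ℝ) : Type :=
  (HeisenbergGroup ℝ × CircleDeg1Liftˣ) ⧸ Subgroup.zpowers (centralTranslation c)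

theorem area_sub_displacement_mul_of_mem_zpowers {c : ℝ} (p : HeisenbergGroup ℝ × CircleDeg1Liftˣ)
    {q : HeisenbergGroup ℝ × CircleDeg1Liftˣ}
    (hq : q ∈ Subgroup.zpowers (centralTranslation c)) :
    (p * q).1.z - c * (p * q).2 0 = p.1.z - c * p.2 0 := by
  rw [Subgroup.zpowers_eq_closure] at hq
  induction hq using Subgroup.closure_induction generalizing p with
  | mem q h =>
    obtain rfl := Set.mem_singleton_iff.1 h
    have hperiod : (p.2 : CircleDeg1Lift) 1 = (p.2 : CircleDeg1Lift) 0 + 1 := by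
      simpa using (p.2 : CircleDeg1Lift).map_add_one 0
    simp only [centralTranslation, Prod.fst_mul, Prod.snd_mul, HeisenbergGroup.mul_z, Units.val_mul,
      CircleDeg1Lift.mul_apply, CircleDeg1Lift.translate_apply, add_zero, hperiod]
    ring
  | one => rw [mul_one]
  | mul q r _ _ hq hr => rw [← mul_assoc, hr, hq]
  | inv q _ hq => rw [← hq (p * q⁻¹), inv_mul_cancel_right]

/-- The Heisenberg area minus `c` times the displacement of `0`, which is well defined modulo
`centralTranslation c`. -/
noncomputable def areaSubDisplacement (c : ℝ) : HeisenbergCircleGroup c → ℝ :=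
  Quotient.lift (fun p => p.1.z - c * p.2 0) fun p q h => by
    rw [← area_sub_displacement_mul_of_mem_zpowers p (QuotientGroup.leftRel_apply.1 h),
      mul_inv_cancel_left]

theorem isMixedQuasimorphism_areaSubDisplacement (c : ℝ) :
    IsMixedQuasimorphism (commutator (HeisenbergCircleGroup c)) (areaSubDisplacement c)
      |c| (|c| * 3) := by
  let π := QuotientGroup.mk' (Subgroup.zpowers (centralTranslation c))
  have hπ : Function.Surjective π := QuotientGroup.mk'_surjective _
  have hmap : (commutator (HeisenbergGroup ℝ × CircleDeg1Liftˣ)).map π =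
      commutator (HeisenbergCircleGroup c) := by
    rw [commutator_def, commutator_def, Subgroup.map_commutator,
      Subgroup.map_top_of_surjective π hπ]
  have harea := HeisenbergGroup.isMixedQuasimorphism_z.comp
    (MonoidHom.fst (HeisenbergGroup ℝ) CircleDeg1Liftˣ) (commutator_le_comap _)
  have hdisp := isMixedQuasimorphism_circleDeg1Lift_map_zero.comp
    (MonoidHom.snd (HeisenbergGroup ℝ) CircleDeg1Liftˣ) (M := commutator _) le_top
  have hsub := harea.sub (hdisp.const_mul c)
  rw [zero_add, zero_add, mul_one] at hsub
  exact hmap ▸ hsub.of_comp hπ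

theorem abs_areaSubDisplacement_commutatorElement_sub_le (c : ℝ)
    (p q : HeisenbergGroup ℝ × CircleDeg1Liftˣ) :
    |areaSubDisplacement c ⁅(p : HeisenbergCircleGroup c), (q : HeisenbergCircleGroup c)⁆ -
      (p.1.x * q.1.y - q.1.x * p.1.y)| ≤ |c| * 3 := by
  change |⁅p.1, q.1⁆.z - c * ⁅p.2, q.2⁆ 0 - _| ≤ _
  rw [HeisenbergGroup.commutatorElement_eq, sub_sub_cancel_left, abs_neg]
  exact (isMixedQuasimorphism_circleDeg1Lift_map_zero.const_mul c).abs_map_commutator_le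
    p.2 q.2 trivial

theorem exists_oneRelatorGroup_hom {G : Type*} [Group G] {ℓ : ℕ} {g h : G} (hgh : ⁅g, h⁆ ^ ℓ = 1) :
    ∃ φ : OneRelatorGroup ℓ →* G, φ (.of 0) = g ∧ φ (.of 1) = h := by
  have hrel : ∀ r ∈ ({⁅FreeGroup.of (0 : Fin 2), FreeGroup.of 1⁆ ^ ℓ} : Set (FreeGroup (Fin 2))),
      FreeGroup.lift ![g, h] r = 1 := by
    rintro _ rfl
    simpa [map_commutatorElement] using hgh
  exact ⟨PresentedGroup.toGroup hrel, by simp, by simp⟩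

theorem exists_isMixedQuasimorphism_oneRelatorGroup {ℓ : ℕ} (hℓ : 2 ≤ ℓ) :
    ∃ f : OneRelatorGroup ℓ → ℝ,
      IsMixedQuasimorphism (commutator (OneRelatorGroup ℓ)) f ℓ (ℓ * 3) ∧
      ∀ m n : ℕ, |f ⁅(.of 0 : OneRelatorGroup ℓ) ^ m, (.of 1 : OneRelatorGroup ℓ) ^ n⁆ - m * n| ≤
        ℓ * 3 := by
  obtain ⟨A, B, hAB⟩ := exists_commutatorElement_pow_eq_translate_one hℓ
  let p : HeisenbergGroup ℝ × CircleDeg1Liftˣ := (⟨1, 0, 0⟩, A)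
  let q : HeisenbergGroup ℝ × CircleDeg1Liftˣ := (⟨0, 1, 0⟩, B)
  have hpq : ⁅p, q⁆ ^ ℓ = centralTranslation ℓ := by
    refine Prod.ext ?_ hAB
    change ⁅p.1, q.1⁆ ^ ℓ = ⟨0, 0, ℓ⟩
    simp [p, q, HeisenbergGroup.commutatorElement_eq, HeisenbergGroup.central_pow]
  have hrel : ⁅(p : HeisenbergCircleGroup ℓ), (q : HeisenbergCircleGroup ℓ)⁆ ^ ℓ = 1 := by
    refine (QuotientGroup.eq_one_iff (⁅p, q⁆ ^ ℓ)).2 ?_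
    exact hpq ▸ Subgroup.mem_zpowers _
  obtain ⟨φ, hφ₀, hφ₁⟩ := exists_oneRelatorGroup_hom hrel
  refine ⟨areaSubDisplacement ℓ ∘ φ, ?_, fun m n => ?_⟩
  · simpa using (isMixedQuasimorphism_areaSubDisplacement ℓ).comp φ (commutator_le_comap φ)
  · rw [Function.comp_apply, map_commutatorElement, map_pow, map_pow, hφ₀, hφ₁,
      ← QuotientGroup.mk_pow, ← QuotientGroup.mk_pow]
    simpa [p, q, -Prod.pow_mk, HeisenbergGroup.pow_x, HeisenbergGroup.pow_y] using
      abs_areaSubDisplacement_commutatorElement_sub_le ℓ (p ^ m) (q ^ n)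

theorem commutatorElement_pow_right {G : Type*} [Group G] {g h : G} (hgh : Commute ⁅g, h⁆ h)
    (n : ℕ) : ⁅g, h ^ n⁆ = ⁅g, h⁆ ^ n := by
  have hconj : g * h * g⁻¹ = ⁅g, h⁆ * h := by rw [commutatorElement_def, inv_mul_cancel_right]
  rw [commutatorElement_def g, ← conj_pow, hconj, hgh.mul_pow, mul_inv_cancel_right]

theorem commutatorElement_pow_pow_mem_of_pow_eq_one {G : Type*} [Group G] {g h : G} {ℓ : ℕ}
    (hgh : ⁅g, h⁆ ^ ℓ = 1) (n : ℕ) : ⁅g ^ n, h ^ ℓ⁆ ∈ ⁅(⊤ : Subgroup G), commutator G⁆ := by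
  let π := QuotientGroup.mk' ⁅(⊤ : Subgroup G), commutator G⁆
  have hπ (x : G) : π x = 1 ↔ x ∈ ⁅(⊤ : Subgroup G), commutator G⁆ := QuotientGroup.eq_one_iff x
  have hcentral : Commute (π h) (π ⁅g, h⁆) := by
    rw [← commutatorElement_eq_one_iff_commute, ← map_commutatorElement, hπ]
    exact Subgroup.commutator_mem_commutator trivial
      (Subgroup.commutator_mem_commutator trivial trivial)
  rw [map_commutatorElement] at hcentral
  have hcomm : Commute (π g) (π h ^ ℓ) := by
    rw [← commutatorElement_eq_one_iff_commute, commutatorElement_pow_right hcentral.symm,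
      ← map_commutatorElement, ← map_pow, hgh, map_one]
  rw [← hπ, map_commutatorElement, map_pow, map_pow, commutatorElement_eq_one_iff_commute]
  exact hcomm.pow_left n

theorem oneRelatorGroup_relation (ℓ : ℕ) :
    ⁅(.of 0 : OneRelatorGroup ℓ), (.of 1 : OneRelatorGroup ℓ)⁆ ^ ℓ = 1 :=
  (QuotientGroup.eq_one_iff _).2 (Subgroup.subset_normalClosure rfl)

theorem theorem4p1 (ℓ : ℕ) (hℓ : 2 ≤ ℓ) :
    ¬ SclEquivalent (commutator (OneRelatorGroup ℓ)) := by
  obtain ⟨f, hf, hf_commutator⟩ := exists_isMixedQuasimorphism_oneRelatorGroup hℓ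
  refine hf.not_sclEquivalent fun M => ?_
  obtain ⟨n, hn⟩ := exists_nat_gt (M + ℓ * 3)
  refine ⟨.of 0 ^ n, .of 1 ^ ℓ,
    commutatorElement_pow_pow_mem_of_pow_eq_one (oneRelatorGroup_relation ℓ) n, ?_⟩
  have hℓ' : (1 : ℝ) ≤ ℓ := by exact_mod_cast one_le_two.trans hℓ
  calc M < n - ℓ * 3 := by linarith
    _ ≤ n * ℓ - ℓ * 3 := by gcongr; exact le_mul_of_one_le_right n.cast_nonneg hℓ'
    _ ≤ f _ := by linarith [(abs_le.1 (hf_commutator n ℓ)).1]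
    _ ≤ |f _| := le_abs_self _
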